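/- A Markov decision process (MDP) $\mathcal M$ consists of a finite set $S$ of states, a finite set $\mathit{Act}$ of actions, a nonempty set $\gamma(s)\subseteq \mathit{Act}$ of enabled actions for each $s\in S$, a set $\lambda(s)$ of atomic propositions for each $s\in S$, state rewards $\mathrm{rew}(s)\ge 0$, and transition probabilities $\delta(s,\alpha,t)\in[0,1]$ with $\sum_{t\in S}\delta(s,\alpha,t)=1$ for all $s\in S$, $\alpha\in\mathit{Act}$. A scheduler $\sigma$ maps each nonempty finite sequence $s_0\dots s_i$ of states to an action in $\gamma(s_i)$; for an initial state $s=s_0$ it induces the unique probability measure $\Pr_s^\sigma$ on $S^{\omega}$ with $\Pr_s^\sigma(s_0\dots s_j\cdot S^\omega)=\prod_{i<j}\delta(s_i,\sigma(s_0\dots s_i),s_{i+1})$. A path $s_0s_1\dots$ fulfils $a\,\mathsf U\,b$ if there is $j\in\mathbb N$ with $b\in\lambda(s_j)$ and $a\in\lambda(s_i)$ for all $i<j$; it fulfils $a\,\mathsf U_{\le r}\,b$ if such a $j$ exists with, in addition, $\sum_{i<j}\mathrm{rew}(s_i)\le r$. For ${\rhd}\in\{\ge,>\}$ and $p\in[0,1]$,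 the value of $s$ with respect to the query $\varphi=\exists\mathsf P_{\rhd p}(a\,\mathsf U_{\le ?}\,b)$ is $$\mathrm{val}_\varphi(s)=\inf\{r\in\mathbb R:\ \Pr_s^\sigma(a\,\mathsf U_{\le r}\,b)\rhd p\ \text{for some scheduler }\sigma\}\in\mathbb R\cup\{\pm\infty\},\qquad \inf\emptyset=\infty .$$ **Lemma.** Let $\mathcal M$ be an MDP whose state rewards are natural numbers and whose transition probabilities $\delta(s,\alpha,t)$, $\alpha\in\gamma(s)$, are rational numbers with denominator (in lowest terms) at most $m$. Let $a,b$ be atomic propositions, ${\rhd}\in\{\ge,>\}$, $p\in[0,1]$, $\varphi=\exists\mathsf P_{\rhd p}(a\,\mathsf U_{\le ?}\,b)$, $n=|\{t\in S: a\in\lambda(t)\}|$, $c=\max\{\mathrm{rew}(t): t\in S,\ a\in\lambda(t)\}$ (with $c=0$ if $n=0$), and $s\in S$. Then the maximum $q=\max_\sigma\Pr_s^\sigma(a\,\mathsf U\,b)$ over all schedulers $\sigma$ exists, and at least one of the following statements holds: 1. $p\ge q$ and $\mathrm{val}_\varphi(s)=\infty$; 2. $p=q$, ${\rhd}={\ge}$,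 and $\mathrm{val}_\varphi(s)\le nc$; 3. $p<q$ and $\mathrm{val}_\varphi(s)\le k\,n\,c\,m^n$, where $k=\max\{-\lfloor\ln(q-p)\rfloor,\,1\}$. -/

import Mathlib

open MeasureTheory ProbabilityTheory
open scoped NNReal ENNReal

/-- A Markov decision process with nonnegative state rewards: `enabled s` is the nonempty set of
actions enabled in `s`, `label s` the set of atomic propositions true in `s`, and `δ s α t` the
probability to move from `s` to `t` under the action `α`. -/
structure MDP (S Act AP : Type*) [Fintype S] where
  enabled : S → Set Act
  enabled_nonempty : ∀ s, (enabled s).Nonempty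
  label : S → Set AP
  rew : S → ℝ≥0
  δ : S → Act → S → ℝ
  δ_nonneg : ∀ s α t, 0 ≤ δ s α t
  δ_sum : ∀ s α, ∑ t, δ s α t = 1

namespace MDP

variable {S Act AP : Type*} [Fintype S]

/-- A (deterministic, history-dependent) scheduler: it maps every nonempty finite sequence
`s₀ s₁ … sₙ` of states to an action that is enabled in the last state `sₙ`. -/
structure Scheduler (M : MDP S Act AP) where
  act : (n : ℕ) → (Finset.Iic n → S) → Act
  act_mem : ∀ (n : ℕ) (h : Finset.Iic n → S),
    act n h ∈ M.enabled (h ⟨n, Finset.mem_Iic.2 le_rfl⟩)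

section PathMeasure

variable [MeasurableSpace S] [DiscreteMeasurableSpace S]

/-- The distribution of the successor of `s` under the action `α`. -/
noncomputable def stepMeasure (M : MDP S Act AP) (s : S) (α : Act) : Measure S :=
  ∑ t, ENNReal.ofReal (M.δ s α t) • Measure.dirac t

instance (M : MDP S Act AP) (s : S) (α : Act) : IsProbabilityMeasure (M.stepMeasure s α) := by
  refine ⟨?_⟩
  simp only [stepMeasure, Measure.coe_finsetSum, Finset.sum_apply, Measure.smul_apply,
    measure_univ, smul_eq_mul, mul_one]
  rw [← ENNReal.ofReal_sum_of_nonneg fun t _ => M.δ_nonneg s α t, M.δ_sum, ENNReal.ofReal_one]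

/-- The kernel giving the state at time `n + 1` from the states at the times `0, …, n`. -/
noncomputable def stepKernel (M : MDP S Act AP) (σ : M.Scheduler) (n : ℕ) :
    Kernel (Finset.Iic n → S) S :=
  Kernel.ofFunOfCountable fun h =>
    M.stepMeasure (h ⟨n, Finset.mem_Iic.2 le_rfl⟩) (σ.act n h)

instance (M : MDP S Act AP) (σ : M.Scheduler) (n : ℕ) : IsMarkovKernel (M.stepKernel σ n) :=
  ⟨fun h => inferInstanceAs
    (IsProbabilityMeasure (M.stepMeasure (h ⟨n, Finset.mem_Iic.2 le_rfl⟩) (σ.act n h)))⟩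

/-- The probability measure on the infinite state sequences that is induced by the scheduler `σ`
and the initial state `s` (obtained from the Ionescu-Tulcea theorem). -/
noncomputable def pathMeasure (M : MDP S Act AP) (σ : M.Scheduler) (s : S) : Measure (ℕ → S) :=
  Kernel.traj (X := fun _ => S) (M.stepKernel σ) 0 fun _ => s

instance (M : MDP S Act AP) (σ : M.Scheduler) (s : S) :
    IsProbabilityMeasure (M.pathMeasure σ s) := by
  unfold pathMeasure; infer_instance

/-- The characterising property of the path measure: the cylinder `s₀ s₁ … s_k · S^ω` with
`s₀ = s` has probability `∏_{i<k} δ(s_i, σ(s₀ … s_i), s_{i+1})`. -/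
theorem pathMeasure_cylinder (M : MDP S Act AP) (σ : M.Scheduler) (w : ℕ → S) (k : ℕ) :
    (M.pathMeasure σ (w 0)).real {π | ∀ i ≤ k, π i = w i} =
      ∏ i ∈ Finset.range k, M.δ (w i) (σ.act i fun j => w j) (w (i + 1)) := by
  have hx : ∀ n, {π : ℕ → S | ∀ i ≤ n, π i = w i} =
      Preorder.frestrictLe (π := fun _ => S) n ⁻¹' {fun j : Finset.Iic n => w j} := by
    intro n
    ext π
    simp only [Set.mem_ofPred_eq, Set.mem_preimage, Set.mem_singleton_iff, funext_iff,
      Subtype.forall, Finset.mem_Iic, Preorder.frestrictLe_apply]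
  induction k with
  | zero =>
    have h := Kernel.traj_map_frestrictLe_apply (X := fun _ => S) (κ := M.stepKernel σ) 0 0
      (fun _ => w 0)
    rw [Kernel.partialTraj_self, Kernel.id_apply] at h
    rw [hx, measureReal_def, ← Measure.map_apply (by fun_prop) (MeasurableSet.singleton _),
      pathMeasure, h, Measure.dirac_apply' _ (MeasurableSet.singleton _)]
    have : (fun _ : Finset.Iic 0 => w 0) = fun j : Finset.Iic 0 => w j := by
      funext j
      obtain ⟨j, hj⟩ := j
      have : j = 0 := by simpa using hj
      subst this
      rfl
    simp [this]
  | succ k ih =>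
    have h := Kernel.partialTraj_compProd_eq_map_traj (X := fun _ => S) (κ := M.stepKernel σ)
      (Nat.zero_le k) (x₀ := fun _ => w 0)
    rw [← Kernel.traj_map_frestrictLe_apply] at h
    have hset : {π : ℕ → S | ∀ i ≤ k + 1, π i = w i} =
        (fun x : ℕ → S => (Preorder.frestrictLe (π := fun _ => S) k x, x (k + 1))) ⁻¹'
          ({fun j : Finset.Iic k => w j} ×ˢ {w (k + 1)}) := by
      ext π
      simp only [Set.mem_ofPred_eq, Set.mem_preimage, Set.mem_prod, Set.mem_singleton_iff,
        funext_iff, Subtype.forall, Finset.mem_Iic, Preorder.frestrictLe_apply]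
      constructor
      · exact fun H => ⟨fun i hi => H i (by omega), H _ le_rfl⟩
      · rintro ⟨H1, H2⟩ i hi
        rcases Nat.lt_or_ge k i with h' | h'
        · obtain rfl : i = k + 1 := by omega
          exact H2
        · exact H1 i h'
    rw [hset, Finset.prod_range_succ, ← ih, hx, measureReal_def, measureReal_def,
      ← Measure.map_apply (by fun_prop)
        ((MeasurableSet.singleton _).prod (MeasurableSet.singleton _)), pathMeasure, ← h,
      Measure.compProd_apply_prod (MeasurableSet.singleton _) (MeasurableSet.singleton _),
      lintegral_singleton, ENNReal.toReal_mul, mul_comm,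
      Measure.map_apply (by fun_prop) (MeasurableSet.singleton _)]
    congr 1
    change (M.stepMeasure (w k) (σ.act k fun j => w j) {w (k + 1)}).toReal = _
    classical
    simp [stepMeasure, Set.indicator_apply, M.δ_nonneg]

end PathMeasure

/-- The paths that fulfil `a U b`. -/
def untilSet (M : MDP S Act AP) (a b : AP) : Set (ℕ → S) :=
  {π | ∃ k, b ∈ M.label (π k) ∧ ∀ i < k, a ∈ M.label (π i)}

/-- The paths that fulfil `a U_{≤ r} b`; the reward of a state is earned upon leaving it. -/
def untilLeSet (M : MDP S Act AP) (a b : AP) (r : ℝ) : Set (ℕ → S) :=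
  {π | ∃ k, b ∈ M.label (π k) ∧ (∀ i < k, a ∈ M.label (π i)) ∧
    ∑ i ∈ Finset.range k, (M.rew (π i) : ℝ) ≤ r}

/-- The comparison operators `≥` and `>`. -/
inductive LowerCmp
  | ge
  | gt

/-- `x ⊳ p` for `⊳` one of `≥` and `>`. -/
def LowerCmp.holds : LowerCmp → ℝ → ℝ → Prop
  | .ge, x, p => x ≥ p
  | .gt, x, p => x > p

/-- `s ⊨ ∃P_{⊳ p} (a U_{≤ r} b)`: the probability of `a U_{≤ r} b` from `s` is `⊳ p` under some
scheduler. -/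
def ExistsUntilLe [MeasurableSpace S] [DiscreteMeasurableSpace S] (M : MDP S Act AP)
    (cmp : LowerCmp) (p : ℝ) (a b : AP) (r : ℝ) (s : S) : Prop :=
  ∃ σ : M.Scheduler, cmp.holds ((M.pathMeasure σ s).real (M.untilLeSet a b r)) p

/-- The value of the state `s` with respect to the query `∃P_{⊳ p} (a U_{≤ ?} b)`: the infimum, in
the extended reals, of all real `r` with `s ⊨ ∃P_{⊳ p} (a U_{≤ r} b)` (so `⊤` if there is none). -/
noncomputable def existsUntilValue [MeasurableSpace S] [DiscreteMeasurableSpace S]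
    (M : MDP S Act AP) (cmp : LowerCmp) (p : ℝ) (a b : AP) (s : S) : EReal :=
  sInf ((fun r : ℝ => (r : EReal)) '' {r : ℝ | M.ExistsUntilLe cmp p a b r s})

/-- The set of states labelled with `a`. -/
def labelled (M : MDP S Act AP) (a : AP) : Set S :=
  {s | a ∈ M.label s}

/-- The largest reward of a state labelled with `a` (`0` if there is no such state). -/
noncomputable def maxRew (M : MDP S Act AP) (a : AP) : ℝ≥0 :=
  sSup (M.rew '' M.labelled a)

end MDP

/-! Values are defined by a Bellman recursion on a finite horizon; `optValue` is their supremum, and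
cost function `0` gives the unbounded maximum `q`. Since `Act` is finite, the supremum satisfies the
Bellman equation. Actions preserving the value need not realise it, as they may cycle forever
without reaching `b`. However, `b` is reachable by such actions from every state of positive value
(`exists_reachOpt`), so an `OptimalPolicy` also moves along shortest such routes. If these routes
have length at most `N` and positive probabilities are at least `ε`, each block of `N` steps shrinks
the worst loss by the factor `1 - ε ^ N` (`loss_le_pow`); hence the policy is optimal.

Case `p < q`: without costs a shortest route visits distinct `a`-states, so `N = n` and `ε = 1/m`
are allowed. After `k * m ^ n` blocks the loss is below `exp (-k) ≤ q - p`, and each of the at most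
`n * k * m ^ n` steps costs at most `c`.

Case `p ≥ q`: either no bound works and the value is `⊤`, or some bound attains `q`, which forces `p
= q` and `≥`. In the latter situation let the level of a state be the least budget attaining its
unbounded value. A level above `c` exceeds some smaller level by at most `c`
(`optValue_eq_free_pred`). Positive levels occur only at `a`-states, so finite levels are at most `n
* c` (`optValue_ncard_mul_eq_free`). -/

set_option linter.unusedSectionVars false

namespace MDP

/-! ### Bellman recursions and one-step expectations -/

section Values

variable {S Act AP : Type*} [Fintype S] (M : MDP S Act AP) (a b : AP) (w : S → ℕ)

/-- The expected value of `f` after one step with action `α` from `t`. -/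
noncomputable def expect (t : S) (α : Act) (f : S → ℝ) : ℝ := ∑ t', M.δ t α t' * f t'

open Classical in
/-- The maximal probability to fulfil `a U b` in fewer than `k` steps with `w`-budget `r`. -/
noncomputable def horizonValue : ℕ → S → ℕ → ℝ
  | 0, _, _ => 0
  | k + 1, t, r =>
    if b ∈ M.label t then 1
    else if a ∈ M.label t ∧ w t ≤ r then
      ⨆ α : M.enabled t, M.expect t α fun t' => horizonValue k t' (r - w t)
    else 0

open Classical in
/-- The probability to fulfil `a U b` in fewer than `k` steps with `w`-budget `r` under a policy
that depends only on the current state and the remaining budget. -/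
noncomputable def policyValue (μ : S → ℕ → Act) : ℕ → S → ℕ → ℝ
  | 0, _, _ => 0
  | k + 1, t, r =>
    if b ∈ M.label t then 1
    else if a ∈ M.label t ∧ w t ≤ r then
      M.expect t (μ t r) fun t' => policyValue μ k t' (r - w t)
    else 0

/-- The maximal probability to fulfil `a U b` with `w`-budget `r`. -/
noncomputable def optValue (t : S) (r : ℕ) : ℝ := ⨆ k, M.horizonValue a b w k t r

variable {M a b w}

theorem expect_mono {t : S} {α : Act} {f g : S → ℝ} (h : ∀ t', 0 < M.δ t α t' → f t' ≤ g t') :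
    M.expect t α f ≤ M.expect t α g := by
  refine Finset.sum_le_sum fun t' _ => ?_
  rcases (M.δ_nonneg t α t').eq_or_lt with h0 | h0
  · simp [← h0]
  · exact mul_le_mul_of_nonneg_left (h t' h0) h0.le

theorem expect_const (t : S) (α : Act) (x : ℝ) : M.expect t α (fun _ => x) = x := by
  rw [expect, ← Finset.sum_mul, M.δ_sum, one_mul]

theorem expect_const_mul (t : S) (α : Act) (x : ℝ) (f : S → ℝ) :
    M.expect t α (fun t' => x * f t') = x * M.expect t α f := by
  simp only [expect, Finset.mul_sum]
  exact Finset.sum_congr rfl fun _ _ => by ring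

theorem expect_sub (t : S) (α : Act) (f g : S → ℝ) :
    M.expect t α (fun t' => f t' - g t') = M.expect t α f - M.expect t α g := by
  simp only [expect, mul_sub, Finset.sum_sub_distrib]

theorem expect_nonneg {t : S} {α : Act} {f : S → ℝ} (h : ∀ t', 0 ≤ f t') :
    0 ≤ M.expect t α f :=
  Finset.sum_nonneg fun t' _ => mul_nonneg (M.δ_nonneg t α t') (h t')

theorem expect_eq_imp {t : S} {α : Act} {f g : S → ℝ} (h : ∀ t', f t' ≤ g t')
    (hle : M.expect t α g ≤ M.expect t α f) {t' : S} (ht : 0 < M.δ t α t') : f t' = g t' := by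
  have h1 : ∀ t' ∈ Finset.univ, M.δ t α t' * f t' ≤ M.δ t α t' * g t' :=
    fun t' _ => mul_le_mul_of_nonneg_left (h t') (M.δ_nonneg t α t')
  have h2 := (Finset.sum_eq_sum_iff_of_le h1).1 (le_antisymm (Finset.sum_le_sum h1) hle)
    t' (Finset.mem_univ _)
  exact mul_left_cancel₀ ht.ne' h2

theorem expect_le_of_drop {t : S} {α : Act} {f : S → ℝ} {B x : ℝ} {t₀ : S}
    (hB : ∀ t', f t' ≤ B) (hx : f t₀ ≤ B - x) : M.expect t α f ≤ B - M.δ t α t₀ * x := by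
  classical
  have : M.expect t α f ≤ M.expect t α (fun t' => B - if t' = t₀ then x else 0) := by
    refine expect_mono fun t' _ => ?_
    split_ifs with h
    · exact h ▸ hx
    · simpa using hB t'
  refine this.trans (le_of_eq ?_)
  rw [expect_sub, expect_const]
  simp [expect]

theorem continuous_expect {t : S} {α : Act} {f : ℕ → S → ℝ} {g : S → ℝ}
    (h : ∀ t', Filter.Tendsto (fun k => f k t') Filter.atTop (nhds (g t'))) :
    Filter.Tendsto (fun k => M.expect t α (f k)) Filter.atTop (nhds (M.expect t α g)) :=
  tendsto_finsetSum _ fun t' _ => (h t').const_mul _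

/-! ### Finite-horizon values -/

section Horizon

theorem horizonValue_goal {k : ℕ} {t : S} {r : ℕ} (h : b ∈ M.label t) :
    M.horizonValue a b w (k + 1) t r = 1 := by simp [horizonValue, h]

theorem horizonValue_stuck {k : ℕ} {t : S} {r : ℕ} (h : b ∉ M.label t)
    (h' : ¬(a ∈ M.label t ∧ w t ≤ r)) : M.horizonValue a b w k t r = 0 := by
  cases k <;> simp [horizonValue, h, h']

theorem policyValue_goal {μ : S → ℕ → Act} {k : ℕ} {t : S} {r : ℕ} (h : b ∈ M.label t) :
    M.policyValue a b w μ (k + 1) t r = 1 := by simp [policyValue, h]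

theorem policyValue_stuck {μ : S → ℕ → Act} {k : ℕ} {t : S} {r : ℕ} (h : b ∉ M.label t)
    (h' : ¬(a ∈ M.label t ∧ w t ≤ r)) : M.policyValue a b w μ k t r = 0 := by
  cases k <;> simp [policyValue, h, h']

theorem policyValue_step {μ : S → ℕ → Act} {k : ℕ} {t : S} {r : ℕ} (h : b ∉ M.label t)
    (h' : a ∈ M.label t ∧ w t ≤ r) : M.policyValue a b w μ (k + 1) t r =
      M.expect t (μ t r) fun t' => M.policyValue a b w μ k t' (r - w t) := by
  simp [policyValue, h, h']

theorem horizonValue_step_le {k : ℕ} {t : S} {r : ℕ} {x : ℝ} (h : b ∉ M.label t)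
    (h' : a ∈ M.label t ∧ w t ≤ r)
    (hx : ∀ α ∈ M.enabled t, (M.expect t α fun t' => M.horizonValue a b w k t' (r - w t)) ≤ x) :
    M.horizonValue a b w (k + 1) t r ≤ x := by
  have := (M.enabled_nonempty t).to_subtype
  simp only [horizonValue, h, h', if_false, if_true, and_self]
  exact ciSup_le fun α => hx α α.2

theorem le_horizonValue_step [Finite Act] {k : ℕ} {t : S} {r : ℕ} (h : b ∉ M.label t)
    (h' : a ∈ M.label t ∧ w t ≤ r) {α : Act} (hα : α ∈ M.enabled t) :
    (M.expect t α fun t' => M.horizonValue a b w k t' (r - w t)) ≤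
      M.horizonValue a b w (k + 1) t r := by
  simp only [horizonValue, h, h', if_false, if_true, and_self]
  exact le_ciSup (f := fun α : M.enabled t =>
    M.expect t α fun t' => M.horizonValue a b w k t' (r - w t))
    (Set.finite_range _).bddAbove ⟨α, hα⟩

theorem horizonValue_le_one (k : ℕ) (t : S) (r : ℕ) : M.horizonValue a b w k t r ≤ 1 := by
  induction k generalizing t r with
  | zero => simp [horizonValue]
  | succ k ih =>
    by_cases h : b ∈ M.label t
    · exact (horizonValue_goal h).le
    by_cases h' : a ∈ M.label t ∧ w t ≤ r
    · refine horizonValue_step_le h h' fun α _ => ?_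
      rw [← expect_const (M := M) t α 1]
      exact expect_mono fun _ _ => ih _ _
    · rw [horizonValue_stuck h h']; exact zero_le_one

variable [Finite Act]

theorem horizonValue_nonneg (k : ℕ) (t : S) (r : ℕ) : 0 ≤ M.horizonValue a b w k t r := by
  induction k generalizing t r with
  | zero => simp [horizonValue]
  | succ k ih =>
    by_cases h : b ∈ M.label t
    · rw [horizonValue_goal h]; exact zero_le_one
    by_cases h' : a ∈ M.label t ∧ w t ≤ r
    · obtain ⟨α, hα⟩ := M.enabled_nonempty t
      exact (expect_nonneg fun t' => ih _ _).trans (le_horizonValue_step h h' hα)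
    · rw [horizonValue_stuck h h']

theorem horizonValue_monotone (t : S) (r : ℕ) :
    Monotone fun k => M.horizonValue a b w k t r := by
  refine monotone_nat_of_le_succ fun k => ?_
  induction k generalizing t r with
  | zero => exact horizonValue_nonneg _ _ _
  | succ k ih =>
    by_cases h : b ∈ M.label t
    · rw [horizonValue_goal h, horizonValue_goal h]
    by_cases h' : a ∈ M.label t ∧ w t ≤ r
    · exact horizonValue_step_le h h' fun α hα =>
        (expect_mono fun t' _ => ih _ _).trans (le_horizonValue_step h h' hα)
    · rw [horizonValue_stuck h h', horizonValue_stuck h h']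

theorem horizonValue_mono_budget (k : ℕ) (t : S) {r r' : ℕ} (hr : r ≤ r') :
    M.horizonValue a b w k t r ≤ M.horizonValue a b w k t r' := by
  induction k generalizing t r r' with
  | zero => exact le_rfl
  | succ k ih =>
    by_cases h : b ∈ M.label t
    · rw [horizonValue_goal h, horizonValue_goal h]
    by_cases h' : a ∈ M.label t ∧ w t ≤ r
    · exact horizonValue_step_le h h' fun α hα => (expect_mono fun t' _ =>
        ih _ (Nat.sub_le_sub_right hr _)).trans
          (le_horizonValue_step h ⟨h'.1, h'.2.trans hr⟩ hα)
    · rw [horizonValue_stuck h h']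
      exact horizonValue_nonneg _ _ _

/-- Dropping the costs only removes a constraint. Under zero cost the budget never changes, so `0`
serves as the canonical one. -/
theorem horizonValue_le_free (k : ℕ) (t : S) (r : ℕ) :
    M.horizonValue a b w k t r ≤ M.horizonValue a b 0 k t 0 := by
  induction k generalizing t r with
  | zero => exact le_rfl
  | succ k ih =>
    by_cases h : b ∈ M.label t
    · rw [horizonValue_goal h, horizonValue_goal h]
    by_cases h' : a ∈ M.label t ∧ w t ≤ r
    · exact horizonValue_step_le h h' fun α hα => (expect_mono fun t' _ => ih _ _).trans
          (le_horizonValue_step (w := 0) (r := 0) h ⟨h'.1, le_rfl⟩ hα)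
    · rw [horizonValue_stuck h h']
      exact horizonValue_nonneg _ _ _

end Horizon

/-! ### The Bellman equation for the limit values -/

section Optimal

theorem horizonValue_bddAbove (t : S) (r : ℕ) :
    BddAbove (Set.range fun k => M.horizonValue a b w k t r) :=
  ⟨1, by rintro _ ⟨k, rfl⟩; exact horizonValue_le_one k t r⟩

theorem horizonValue_le_optValue (k : ℕ) (t : S) (r : ℕ) :
    M.horizonValue a b w k t r ≤ M.optValue a b w t r :=
  le_ciSup (horizonValue_bddAbove t r) k

theorem optValue_le {t : S} {r : ℕ} {x : ℝ} (h : ∀ k, M.horizonValue a b w k t r ≤ x) :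
    M.optValue a b w t r ≤ x :=
  ciSup_le h

theorem optValue_le_one (t : S) (r : ℕ) : M.optValue a b w t r ≤ 1 :=
  optValue_le fun k => horizonValue_le_one k t r

theorem optValue_nonneg (t : S) (r : ℕ) : 0 ≤ M.optValue a b w t r :=
  horizonValue_le_optValue 0 t r

theorem optValue_goal {t : S} (r : ℕ) (h : b ∈ M.label t) : M.optValue a b w t r = 1 :=
  le_antisymm (optValue_le_one t r)
    ((horizonValue_goal (k := 0) h).ge.trans (horizonValue_le_optValue 1 t r))

theorem optValue_stuck {t : S} {r : ℕ} (h : b ∉ M.label t)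
    (h' : ¬(a ∈ M.label t ∧ w t ≤ r)) : M.optValue a b w t r = 0 :=
  le_antisymm (optValue_le fun _ => (horizonValue_stuck h h').le) (optValue_nonneg t r)

variable [Finite Act]

theorem optValue_mono_budget (t : S) {r r' : ℕ} (hr : r ≤ r') :
    M.optValue a b w t r ≤ M.optValue a b w t r' :=
  optValue_le fun k => (horizonValue_mono_budget k t hr).trans (horizonValue_le_optValue k t r')

theorem optValue_le_free (t : S) (r : ℕ) : M.optValue a b w t r ≤ M.optValue a b 0 t 0 :=
  optValue_le fun k => (horizonValue_le_free k t r).trans (horizonValue_le_optValue k t 0)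

theorem tendsto_horizonValue (t : S) (r : ℕ) :
    Filter.Tendsto (fun k => M.horizonValue a b w k t r) Filter.atTop
      (nhds (M.optValue a b w t r)) :=
  tendsto_atTop_ciSup (horizonValue_monotone t r) (horizonValue_bddAbove t r)

theorem expect_optValue_le {t : S} {r : ℕ} (h : b ∉ M.label t)
    (h' : a ∈ M.label t ∧ w t ≤ r) {α : Act} (hα : α ∈ M.enabled t) :
    (M.expect t α fun t' => M.optValue a b w t' (r - w t)) ≤ M.optValue a b w t r :=
  le_of_tendsto (continuous_expect fun _ => tendsto_horizonValue _ _)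
    (Filter.Eventually.of_forall fun k =>
      (le_horizonValue_step h h' hα).trans (horizonValue_le_optValue (k + 1) t r))

theorem exists_expect_optValue_eq {t : S} {r : ℕ} (h : b ∉ M.label t)
    (h' : a ∈ M.label t ∧ w t ≤ r) : ∃ α ∈ M.enabled t,
      (M.expect t α fun t' => M.optValue a b w t' (r - w t)) = M.optValue a b w t r := by
  obtain ⟨α, hα, hmax⟩ := Set.exists_max_image (M.enabled t)
    (fun α => M.expect t α fun t' => M.optValue a b w t' (r - w t)) (Set.toFinite _)
    (M.enabled_nonempty t)
  refine ⟨α, hα, le_antisymm (expect_optValue_le h h' hα) (optValue_le fun k => ?_)⟩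
  refine (horizonValue_monotone t r (Nat.le_succ k)).trans (horizonValue_step_le h h' ?_)
  exact fun β hβ => (expect_mono fun _ _ => horizonValue_le_optValue _ _ _).trans (hmax β hβ)

/-! ### Value-preserving routes to the goal and optimal policies -/

variable (M a b w) in
/-- From the state `t` with budget `r` one can reach a `b`-state in exactly `j` steps using
value-preserving actions only. -/
def ReachOpt : ℕ → S → ℕ → Prop
  | 0, t, _ => b ∈ M.label t
  | j + 1, t, r => b ∉ M.label t ∧ (a ∈ M.label t ∧ w t ≤ r) ∧ ∃ α ∈ M.enabled t,
      (M.expect t α fun t' => M.optValue a b w t' (r - w t)) = M.optValue a b w t r ∧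
      ∃ t', 0 < M.δ t α t' ∧ ReachOpt j t' (r - w t)

theorem exists_uniform_factor {ι : Type*} [Finite ι] (f g : ι → ℝ) (hf : ∀ i, 0 ≤ f i) :
    ∃ l : ℝ, 0 ≤ l ∧ l < 1 ∧ ∀ i, f i < g i → f i ≤ l * g i := by
  classical
  cases nonempty_fintype ι
  -- The extra point with value `0` covers an empty `ι` and makes the maximum nonnegative.
  let h : Option ι → ℝ := fun o => o.elim 0 fun i => if f i < g i then f i / g i else 0
  obtain ⟨o, ho⟩ := Finite.exists_max h
  refine ⟨h o, ho none, ?_, fun i hi => ?_⟩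
  · rcases o with _ | i
    · exact zero_lt_one
    · simp only [h, Option.elim]
      split_ifs with hi
      · exact (div_lt_one ((hf i).trans_lt hi)).2 hi
      · exact zero_lt_one
  · have := ho (some i)
    simp only [h, Option.elim, if_pos hi] at this
    exact (div_le_iff₀ ((hf i).trans_lt hi)).1 this

/-- If value-preserving actions never lead to `b`, every success uses a strictly suboptimal action
at some point, which costs a uniform factor `l < 1`. Then the value is at most `l` times itself,
hence not positive. -/
theorem exists_reachOpt {t : S} {r : ℕ} (hpos : 0 < M.optValue a b w t r) :
    ∃ j, M.ReachOpt a b w j t r := by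
  obtain ⟨l, hl0, hl1, hl⟩ := exists_uniform_factor
    -- Budgets only decrease, so finitely many triples matter and one factor serves them all.
    (fun i : S × Fin (r + 1) × Act =>
      M.expect i.1 i.2.2 fun t' => M.optValue a b w t' (i.2.1 - w i.1))
    (fun i => M.optValue a b w i.1 i.2.1) (fun i => expect_nonneg fun t' => optValue_nonneg _ _)
  have key : ∀ k t r', r' ≤ r → (∀ j, ¬M.ReachOpt a b w j t r') →
      M.horizonValue a b w k t r' ≤ l * M.optValue a b w t r' := by
    intro k
    induction k with
    | zero => exact fun t r' _ _ => mul_nonneg hl0 (optValue_nonneg _ _)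
    | succ k ih =>
      intro t r' hr' hn
      have h : b ∉ M.label t := hn 0
      by_cases h' : a ∈ M.label t ∧ w t ≤ r'
      · refine horizonValue_step_le h h' fun α hα => ?_
        rcases (expect_optValue_le h h' hα).eq_or_lt with he | hlt
        · rw [← he, ← expect_const_mul]
          refine expect_mono fun t' ht' => ih t' _ (by omega) fun j hj => ?_
          exact hn (j + 1) ⟨h, h', α, hα, he, t', ht', hj⟩
        · exact (expect_mono fun _ _ => horizonValue_le_optValue _ _ _).trans
            (hl (t, ⟨r', by omega⟩, α) hlt)
      · rw [horizonValue_stuck h h', optValue_stuck h h', mul_zero]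
  by_contra! hn
  have := optValue_le fun k => key k t r le_rfl hn
  nlinarith

/-- A policy that plays value-preserving actions and approaches the `b`-states. -/
structure OptimalPolicy (M : MDP S Act AP) (a b : AP) (w : S → ℕ) (μ : S → ℕ → Act) : Prop where
  mem : ∀ t r, μ t r ∈ M.enabled t
  preserve : ∀ t r, b ∉ M.label t → a ∈ M.label t ∧ w t ≤ r →
    (M.expect t (μ t r) fun t' => M.optValue a b w t' (r - w t)) = M.optValue a b w t r
  approach : ∀ j t r, M.ReachOpt a b w (j + 1) t r → (∀ i ≤ j, ¬M.ReachOpt a b w i t r) →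
    ∃ t', 0 < M.δ t (μ t r) t' ∧ M.ReachOpt a b w j t' (r - w t)

variable (M a b w) in
theorem exists_optimalPolicy : ∃ μ, OptimalPolicy M a b w μ := by
  have : ∀ t r, ∃ α ∈ M.enabled t, (b ∉ M.label t → a ∈ M.label t ∧ w t ≤ r →
      (M.expect t α fun t' => M.optValue a b w t' (r - w t)) = M.optValue a b w t r) ∧
      ∀ j, M.ReachOpt a b w (j + 1) t r → (∀ i ≤ j, ¬M.ReachOpt a b w i t r) →
        ∃ t', 0 < M.δ t α t' ∧ M.ReachOpt a b w j t' (r - w t) := by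
    intro t r
    by_cases hex : ∃ j, M.ReachOpt a b w (j + 1) t r ∧ ∀ i ≤ j, ¬M.ReachOpt a b w i t r
    · obtain ⟨j, ⟨h, h', α, hα, he, t', ht', hj⟩, hmin⟩ := hex
      refine ⟨α, hα, fun _ _ => he, fun i hi hi' => ?_⟩
      -- The shortest distance is unique, so the single action chosen for it meets the requirement
      -- for every index.
      obtain rfl : i = j := by
        by_contra hne
        rcases Nat.lt_or_gt_of_ne hne with hlt | hlt
        · exact hmin (i + 1) hlt hi
        · exact hi' (j + 1) hlt ⟨h, h', α, hα, he, t', ht', hj⟩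
      exact ⟨t', ht', hj⟩
    · by_cases h : b ∉ M.label t ∧ a ∈ M.label t ∧ w t ≤ r
      · obtain ⟨α, hα, he⟩ := exists_expect_optValue_eq h.1 h.2
        exact ⟨α, hα, fun _ _ => he, fun j hj hj' => (hex ⟨j, hj, hj'⟩).elim⟩
      · obtain ⟨α, hα⟩ := M.enabled_nonempty t
        exact ⟨α, hα, fun h1 h2 => (h ⟨h1, h2⟩).elim, fun j hj hj' => (hex ⟨j, hj, hj'⟩).elim⟩
  choose μ h1 h2 h3 using this
  exact ⟨μ, h1, h2, fun j t r => h3 t r j⟩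

variable {μ : S → ℕ → Act}

theorem policyValue_nonneg (k : ℕ) (t : S) (r : ℕ) : 0 ≤ M.policyValue a b w μ k t r := by
  induction k generalizing t r with
  | zero => exact le_rfl
  | succ k ih =>
    by_cases h : b ∈ M.label t
    · rw [policyValue_goal h]; exact zero_le_one
    by_cases h' : a ∈ M.label t ∧ w t ≤ r
    · rw [policyValue_step h h']
      exact expect_nonneg fun _ => ih _ _
    · rw [policyValue_stuck h h']

theorem policyValue_le_optValue (hμ : ∀ t r, μ t r ∈ M.enabled t) (k : ℕ) (t : S) (r : ℕ) :
    M.policyValue a b w μ k t r ≤ M.optValue a b w t r := by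
  induction k generalizing t r with
  | zero => exact optValue_nonneg _ _
  | succ k ih =>
    by_cases h : b ∈ M.label t
    · rw [policyValue_goal h, optValue_goal r h]
    by_cases h' : a ∈ M.label t ∧ w t ≤ r
    · rw [policyValue_step h h']
      exact (expect_mono fun _ _ => ih _ _).trans (expect_optValue_le h h' (hμ t r))
    · rw [policyValue_stuck h h']
      exact optValue_nonneg _ _

/-! ### Geometric decay of the finite-horizon loss -/

/-- The loss of an optimal policy with a finite horizon is propagated by one step. -/
theorem OptimalPolicy.loss_step (hμ : OptimalPolicy M a b w μ) {k : ℕ} {t : S} {r : ℕ}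
    (h : b ∉ M.label t) (h' : a ∈ M.label t ∧ w t ≤ r) :
    M.optValue a b w t r - M.policyValue a b w μ (k + 1) t r = M.expect t (μ t r) fun t' =>
      M.optValue a b w t' (r - w t) - M.policyValue a b w μ k t' (r - w t) := by
  rw [expect_sub, hμ.preserve t r h h', policyValue_step h h']

theorem OptimalPolicy.loss_le_add (hμ : OptimalPolicy M a b w μ) {k R : ℕ} {B : ℝ} (hB : 0 ≤ B)
    (hk : ∀ t, ∀ r ≤ R, M.optValue a b w t r - M.policyValue a b w μ k t r ≤ B) (j : ℕ) :
    ∀ t, ∀ r ≤ R, M.optValue a b w t r - M.policyValue a b w μ (k + j) t r ≤ B := by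
  induction j with
  | zero => exact hk
  | succ j ih =>
    intro t r hr
    rw [← add_assoc]
    by_cases h : b ∈ M.label t
    · rw [policyValue_goal h, optValue_goal r h, sub_self]; exact hB
    by_cases h' : a ∈ M.label t ∧ w t ≤ r
    · rw [hμ.loss_step h h', ← expect_const (M := M) t (μ t r) B]
      exact expect_mono fun t' _ => ih t' _ (by omega)
    · rw [policyValue_stuck h h', optValue_stuck h h', sub_self]; exact hB

/-- At each step the successor nearer to the goal has probability at least `ε`, while all other
successors still lose at most `B`. Following the route thus saves `ε ^ j * B`. The horizon `k + 1`
is positive, so a goal state has loss zero. -/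
theorem OptimalPolicy.loss_le_of_reachOpt (hμ : OptimalPolicy M a b w μ) {k R : ℕ} {B ε : ℝ}
    (hB : 0 ≤ B) (hε0 : 0 ≤ ε) (hε1 : ε ≤ 1)
    (hε : ∀ t, ∀ α ∈ M.enabled t, ∀ t', 0 < M.δ t α t' → ε ≤ M.δ t α t')
    (hk : ∀ t, ∀ r ≤ R, M.optValue a b w t r - M.policyValue a b w μ (k + 1) t r ≤ B) (j : ℕ) :
    ∀ t, ∀ r ≤ R, (∃ i ≤ j, M.ReachOpt a b w i t r) →
      M.optValue a b w t r - M.policyValue a b w μ (k + 1 + j) t r ≤ B - ε ^ j * B := by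
  classical
  induction j with
  | zero =>
    rintro t r hr ⟨i, hi, hreach⟩
    obtain rfl : i = 0 := by omega
    rw [add_zero, policyValue_goal hreach, optValue_goal r hreach]
    simp
  | succ j ih =>
    rintro t r hr ⟨i, hi, hreach⟩
    have hex : ∃ i, M.ReachOpt a b w i t r := ⟨i, hreach⟩
    have hle := (Nat.find_min' hex hreach).trans hi
    have hmin : ∀ i < Nat.find hex, ¬M.ReachOpt a b w i t r := fun i => Nat.find_min hex
    have hfind := Nat.find_spec hex
    generalize Nat.find hex = i₀ at hle hmin hfind
    have hpow : ε ^ (j + 1) * B ≤ B := by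
      have := pow_le_one₀ (n := j + 1) hε0 hε1
      nlinarith
    rw [← add_assoc]
    rcases i₀ with _ | i₀
    · rw [policyValue_goal hfind, optValue_goal r hfind]
      linarith
    · obtain ⟨t₀, ht₀, hr₀⟩ := hμ.approach i₀ t r hfind fun i hi => hmin i (by omega)
      rw [hμ.loss_step hfind.1 hfind.2.1]
      refine (expect_le_of_drop (t₀ := t₀) (B := B) (x := ε ^ j * B)
        (fun t' => ?_) (ih t₀ _ (by omega) ⟨i₀, by omega, hr₀⟩)).trans ?_
      · exact hμ.loss_le_add hB hk j t' _ (by omega)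
      · have := mul_le_mul_of_nonneg_right (hε t _ (hμ.mem t r) t₀ ht₀)
          (mul_nonneg (pow_nonneg hε0 j) hB)
        rw [pow_succ]
        linarith

/-- States of positive value gain a factor in each block of `N` steps by `loss_le_of_reachOpt`;
states of value zero have nothing to lose. -/
theorem OptimalPolicy.loss_le_pow (hμ : OptimalPolicy M a b w μ) {N R : ℕ} {ε : ℝ}
    (hε0 : 0 ≤ ε) (hε1 : ε ≤ 1)
    (hε : ∀ t, ∀ α ∈ M.enabled t, ∀ t', 0 < M.δ t α t' → ε ≤ M.δ t α t')
    (hN : ∀ t, ∀ r ≤ R, 0 < M.optValue a b w t r → ∃ j ≤ N, M.ReachOpt a b w j t r) (K : ℕ) :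
    ∀ t, ∀ r ≤ R, M.optValue a b w t r - M.policyValue a b w μ (N * K + 1) t r ≤
      (1 - ε ^ N) ^ K := by
  have h1 := pow_le_one₀ (n := N) hε0 hε1
  induction K with
  | zero =>
    intro t r _
    have := policyValue_nonneg (M := M) (a := a) (b := b) (w := w) (μ := μ) (N * 0 + 1) t r
    have := optValue_le_one (M := M) (a := a) (b := b) (w := w) t r
    rw [pow_zero]
    linarith
  | succ K ih =>
    intro t r hr
    have hB : 0 ≤ (1 - ε ^ N) ^ K := pow_nonneg (by linarith) K
    rcases (optValue_nonneg (M := M) (a := a) (b := b) (w := w) t r).eq_or_lt with h0 | h0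
    · have := policyValue_nonneg (M := M) (a := a) (b := b) (w := w) (μ := μ) (N * (K + 1) + 1) t r
      have := pow_nonneg (sub_nonneg.2 h1) (K + 1)
      linarith
    · have := hμ.loss_le_of_reachOpt hB hε0 hε1 hε ih N t r hr (hN t r hr h0)
      rw [show N * (K + 1) + 1 = N * K + 1 + N by ring, pow_succ]
      linarith

theorem exists_min_prob (M : MDP S Act AP) : ∃ ε : ℝ, 0 < ε ∧ ε ≤ 1 ∧
    ∀ t α t', 0 < M.δ t α t' → ε ≤ M.δ t α t' := by
  let h : Option (S × Act × S) → ℝ := fun o =>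
    o.elim 1 fun i => if 0 < M.δ i.1 i.2.1 i.2.2 then M.δ i.1 i.2.1 i.2.2 else 1
  obtain ⟨o, ho⟩ := Finite.exists_min h
  refine ⟨h o, ?_, ho none, fun t α t' hpos => ?_⟩
  · rcases o with _ | i
    · exact zero_lt_one
    · simp only [h, Option.elim]
      split_ifs with hi
      · exact hi
      · exact zero_lt_one
  · simpa [h, hpos] using ho (some (t, α, t'))

variable (M a b w) in
theorem exists_rank_bound (R : ℕ) : ∃ N, ∀ t, ∀ r ≤ R, 0 < M.optValue a b w t r →
    ∃ j ≤ N, M.ReachOpt a b w j t r := by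
  choose f hf using fun i : {i : S × Fin (R + 1) // 0 < M.optValue a b w i.1 i.2} =>
    exists_reachOpt i.2
  obtain ⟨N, hN⟩ := (Set.finite_range f).bddAbove
  exact ⟨N, fun t r hr h => ⟨f ⟨(t, ⟨r, by omega⟩), h⟩, hN ⟨_, rfl⟩, hf ⟨(t, ⟨r, by omega⟩), h⟩⟩⟩

/-- The loss tends to zero, so bounds on all finite-horizon policy values pass to the optimum. Here
`ε` and `N` come from finiteness alone. -/
theorem OptimalPolicy.optValue_le (hμ : OptimalPolicy M a b w μ) {t : S} {r : ℕ} {x : ℝ}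
    (h : ∀ k, M.policyValue a b w μ k t r ≤ x) : M.optValue a b w t r ≤ x := by
  obtain ⟨ε, hε0, hε1, hε⟩ := exists_min_prob M
  obtain ⟨N, hN⟩ := exists_rank_bound M a b w r
  have h0 : 0 ≤ 1 - ε ^ N := sub_nonneg.2 (pow_le_one₀ hε0.le hε1)
  have hlim := tendsto_pow_atTop_nhds_zero_of_lt_one h0 (sub_lt_self 1 (pow_pos hε0 N))
  have := ge_of_tendsto hlim (b := M.optValue a b w t r - x)
    (Filter.Eventually.of_forall fun K => by
      have := hμ.loss_le_pow hε0.le hε1 (fun t α _ => hε t α) hN K t r le_rfl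
      have := h (N * K + 1)
      linarith)
  linarith

/-! ### Counting `a`-states: distances and budget levels -/

/-- Without costs, the number of `a`-states bounds the distance to the `b`-states. -/
theorem exists_reachOpt_le_ncard {t : S} (h : 0 < M.optValue a b 0 t 0) :
    ∃ j ≤ (M.labelled a).ncard, M.ReachOpt a b 0 j t 0 := by
  classical
  let rank : S → ℕ := fun t => sInf {j | M.ReachOpt a b 0 j t 0}
  have hrank : ∀ j t, M.ReachOpt a b 0 j t 0 → M.ReachOpt a b 0 (rank t) t 0 :=
    fun j t hj => Nat.sInf_mem (s := {j | M.ReachOpt a b 0 j t 0}) ⟨j, hj⟩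
  have hrank_le : ∀ j t, M.ReachOpt a b 0 j t 0 → rank t ≤ j := fun j t hj => Nat.sInf_le hj
  -- Along a shortest route the rank drops by exactly one, so the `a`-states on it realise every
  -- rank from `1` to `j`.
  have hsub : ∀ j t, rank t = j → M.ReachOpt a b 0 j t 0 →
      (Finset.Icc 1 j : Set ℕ) ⊆ rank '' M.labelled a := by
    intro j
    induction j with
    | zero => simp
    | succ j ih =>
      intro t ht hj i hi
      obtain ⟨hb, ⟨ha, -⟩, α, hα, he, t', ht', hj'⟩ := hj
      simp only [Pi.zero_apply, Nat.sub_zero] at hj' he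
      have h1 : rank t' = j := by
        refine le_antisymm (hrank_le j t' hj') ?_
        have := hrank_le (rank t' + 1) t
          ⟨hb, ⟨ha, le_rfl⟩, α, hα, he, t', ht', by simpa using hrank j t' hj'⟩
        omega
      simp only [Finset.coe_Icc, Set.mem_Icc] at hi
      rcases Nat.lt_or_ge j i with hlt | hle
      · exact ⟨t, ha, by omega⟩
      · exact ih t' h1 hj' (by simp; omega)
  obtain ⟨j, hj⟩ := exists_reachOpt h
  refine ⟨rank t, ?_, hrank j t hj⟩
  have h1 := Set.ncard_le_ncard (hsub _ t rfl (hrank j t hj)) (Set.toFinite _)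
  rw [Set.ncard_coe_finset, Nat.card_Icc] at h1
  exact (by omega : rank t ≤ _).trans (h1.trans (Set.ncard_image_le (Set.toFinite _)))

/-- If no additional state becomes optimal within the last `c` units below `r - 1`, then none
becomes optimal at `r`. -/
theorem optValue_eq_free_pred {c r : ℕ} (hc : ∀ t, a ∈ M.label t → w t ≤ c) (hr : c < r)
    (hgap : ∀ t, M.optValue a b w t (r - 1) = M.optValue a b 0 t 0 →
      M.optValue a b w t (r - 1 - c) = M.optValue a b 0 t 0)
    {t : S} (ht : M.optValue a b w t r = M.optValue a b 0 t 0) :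
    M.optValue a b w t (r - 1) = M.optValue a b 0 t 0 := by
  obtain ⟨μ, hμ⟩ := exists_optimalPolicy M a b w
  -- Induction on the horizon handles zero-cost steps, where the budget makes no progress.
  have key : ∀ k t, M.optValue a b w t r = M.optValue a b 0 t 0 →
      M.policyValue a b w μ k t r ≤ M.optValue a b w t (r - 1) := by
    intro k
    induction k with
    | zero => exact fun t _ => optValue_nonneg _ _
    | succ k ih =>
      intro t ht
      by_cases h : b ∈ M.label t
      · rw [policyValue_goal h, optValue_goal _ h]
      by_cases h' : a ∈ M.label t ∧ w t ≤ r
      · have hwc := hc t h'.1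
        rw [policyValue_step h h']
        refine le_trans (expect_mono fun t' ht' => ?_)
          (expect_optValue_le h ⟨h'.1, by omega⟩ (hμ.mem t r))
        -- The budgeted and free expectations over the successors must agree, so every successor of
        -- positive probability attains its free value with the remaining budget.
        have hfree := expect_optValue_le (w := 0) (r := 0) h ⟨h'.1, le_rfl⟩ (hμ.mem t r)
        rw [← ht, ← hμ.preserve t r h h'] at hfree
        have heq : M.optValue a b w t' (r - w t) = M.optValue a b 0 t' 0 :=
          expect_eq_imp (fun t' => optValue_le_free t' (r - w t)) hfree ht'
        rcases Nat.eq_zero_or_pos (w t) with h0 | h0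
        · rw [h0, Nat.sub_zero] at heq ⊢
          exact ih t' heq
        -- After a positive cost at most `r - 1` remains; by the gap even `r - 1 - c` suffices,
        -- which is no more than what is left when starting from `r - 1`.
        · have h1 : M.optValue a b w t' (r - 1) = M.optValue a b 0 t' 0 :=
            le_antisymm (optValue_le_free _ _)
              (heq.ge.trans (optValue_mono_budget t' (by omega)))
          calc _ ≤ M.optValue a b w t' (r - w t) := policyValue_le_optValue hμ.mem _ _ _
            _ = M.optValue a b w t' (r - 1 - c) := by rw [heq, hgap t' h1]
            _ ≤ _ := optValue_mono_budget t' (by omega)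
      · rw [policyValue_stuck h h']
        exact optValue_nonneg _ _
  exact le_antisymm (optValue_le_free _ _) (ht.ge.trans (hμ.optValue_le fun k => key k t ht))

/-- If some budget suffices for the optimal value, then `n c` does, where `n` is the number of
`a`-states and `c` bounds their costs. -/
theorem optValue_ncard_mul_eq_free {c r : ℕ} (hc : ∀ t, a ∈ M.label t → w t ≤ c) {t : S}
    (ht : M.optValue a b w t r = M.optValue a b 0 t 0) :
    M.optValue a b w t ((M.labelled a).ncard * c) = M.optValue a b 0 t 0 := by
  let opt : S → Set ℕ := fun t => {r | M.optValue a b w t r = M.optValue a b 0 t 0}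
  let lev : S → ℕ := fun t => sInf (opt t)
  have hup : ∀ t r r', r ≤ r' → r ∈ opt t → r' ∈ opt t := fun t r r' h hr =>
    le_antisymm (optValue_le_free _ _) (hr.ge.trans (optValue_mono_budget t h))
  have hlev : ∀ t, (opt t).Nonempty → lev t ∈ opt t := fun t h => Nat.sInf_mem h
  have hlev_le : ∀ t r, r ∈ opt t → lev t ≤ r := fun t r h => Nat.sInf_le h
  have hstuck : ∀ t, 0 < lev t → a ∈ M.label t := by
    intro t h
    by_contra ha
    have : (0 : ℕ) ∈ opt t := by
      by_cases hb : b ∈ M.label t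
      · exact (optValue_goal _ hb).trans (optValue_goal _ hb).symm
      · exact (optValue_stuck hb fun h => ha h.1).trans (optValue_stuck hb fun h => ha h.1).symm
    have := hlev_le t 0 this
    omega
  let N : S → ℕ := fun t => {t' | a ∈ M.label t' ∧ lev t' ≤ lev t}.ncard
  have key : ∀ l t, lev t = l → (opt t).Nonempty → lev t ≤ N t * c := by
    intro l
    induction l using Nat.strong_induction_on with
    | _ l ih =>
      rintro t rfl hne
      rcases Nat.eq_zero_or_pos (lev t) with h0 | hpos
      · rw [h0]; exact Nat.zero_le _
      have hmem : t ∈ {t' | a ∈ M.label t' ∧ lev t' ≤ lev t} := ⟨hstuck t hpos, le_rfl⟩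
      rcases Nat.lt_or_ge c (lev t) with hlt | hle
      · obtain ⟨t', h1, h2⟩ : ∃ t', lev t - 1 ∈ opt t' ∧ lev t - 1 - c ∉ opt t' := by
          by_contra! hgap
          have := hlev_le t _ (optValue_eq_free_pred hc hlt hgap (hlev t hne))
          omega
        have h3 := hlev_le t' _ h1
        have h4 : lev t - 1 - c < lev t' := by
          by_contra! h
          exact h2 (hup t' _ _ h (hlev t' ⟨_, h1⟩))
        have h5 := ih (lev t') (by omega) t' rfl ⟨_, h1⟩
        -- The state `t` is counted in `N t` but not in `N t'`, so the extra `c` is paid for by a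
        -- new `a`-state.
        have h6 : N t' < N t := by
          refine Set.ncard_lt_ncard ⟨fun x hx => ⟨hx.1, hx.2.trans (by omega)⟩, fun hsub => ?_⟩
            (Set.toFinite _)
          have := (hsub hmem).2
          omega
        have := Nat.mul_le_mul_right c h6
        rw [Nat.succ_mul] at this
        omega
      · have : 1 ≤ N t := (Set.ncard_pos (Set.toFinite _)).2 ⟨t, hmem⟩
        nlinarith
  refine hup t _ _ ((key _ t rfl ⟨r, ht⟩).trans (Nat.mul_le_mul_right c ?_)) (hlev t ⟨r, ht⟩)
  exact Set.ncard_le_ncard (fun x hx => hx.1) (Set.toFinite _)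

end Optimal

end Values

end MDP

namespace MDP

/-! ### First-step analysis of the path measure -/

section Paths

variable {S Act AP : Type*} [Fintype S] {M : MDP S Act AP} {a b : AP} {w : S → ℕ}

/-- The infinite sequence `π` preceded by `s`. -/
def consPath (s : S) (π : ℕ → S) : ℕ → S
  | 0 => s
  | i + 1 => π i

/-- The finite sequence `h` preceded by `s`. -/
def consHist (s : S) {n : ℕ} (h : Finset.Iic n → S) : Finset.Iic (n + 1) → S
  | ⟨0, _⟩ => s
  | ⟨i + 1, hi⟩ => h ⟨i, Finset.mem_Iic.2 (Nat.le_of_succ_le_succ (Finset.mem_Iic.1 hi))⟩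

/-- The behaviour of the scheduler `σ` after the first state `s`. -/
def Scheduler.tail (σ : M.Scheduler) (s : S) : M.Scheduler where
  act n h := σ.act (n + 1) (consHist s h)
  act_mem n h := σ.act_mem (n + 1) (consHist s h)

/-- The scheduler that starts with budget `r` and follows the policy `μ`, keeping track of the
remaining budget. -/
def policyScheduler (w : S → ℕ) (μ : S → ℕ → Act) (hμ : ∀ t r, μ t r ∈ M.enabled t) (r : ℕ) :
    M.Scheduler where
  act n h := μ (h ⟨n, Finset.mem_Iic.2 le_rfl⟩)
    (r - ∑ i : Fin n, w (h ⟨i, Finset.mem_Iic.2 i.2.le⟩))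
  act_mem _ _ := hμ _ _

/-- This closure under tails lets the scheduler's probabilities obey the recursion of `policyValue`.
-/
theorem policyScheduler_tail (μ : S → ℕ → Act) (hμ : ∀ t r, μ t r ∈ M.enabled t) (r : ℕ) (s : S) :
    (policyScheduler w μ hμ r).tail s = policyScheduler w μ hμ (r - w s) := by
  simp only [Scheduler.tail, policyScheduler, Scheduler.mk.injEq]
  funext n h
  rw [Fin.sum_univ_succ, Nat.sub_sub]
  rfl

variable (M a b w) in
/-- The paths that fulfil `a U b` in fewer than `k` steps with `w`-budget `r`. -/
def horizonSet (k r : ℕ) : Set (ℕ → S) :=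
  {π | ∃ j < k, b ∈ M.label (π j) ∧ (∀ i < j, a ∈ M.label (π i)) ∧
    ∑ i ∈ Finset.range j, w (π i) ≤ r}

theorem mem_horizonSet_cons {k r : ℕ} {s : S} {π : ℕ → S} :
    consPath s π ∈ M.horizonSet a b w (k + 1) r ↔ b ∈ M.label s ∨
      (a ∈ M.label s ∧ w s ≤ r) ∧ π ∈ M.horizonSet a b w k (r - w s) := by
  constructor
  · rintro ⟨_ | j, hj, hb, ha, hw⟩
    · exact Or.inl hb
    · rw [Finset.sum_range_succ'] at hw
      change ∑ i ∈ Finset.range j, w (π i) + w s ≤ r at hw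
      exact Or.inr ⟨⟨ha 0 (by omega), by omega⟩, j, by omega, hb,
        fun i hi => ha (i + 1) (by omega), by omega⟩
  · rintro (h | ⟨⟨ha, hw⟩, j, hj, hb, ha', hw'⟩)
    · exact ⟨0, by omega, h, by simp, by simp⟩
    · refine ⟨j + 1, by omega, hb, ?_, ?_⟩
      · rintro (_ | i) hi
        · exact ha
        · exact ha' i (by omega)
      · rw [Finset.sum_range_succ']
        change ∑ i ∈ Finset.range j, w (π i) + w s ≤ r
        omega

theorem horizonSet_mono {r : ℕ} : Monotone fun k => M.horizonSet a b w k r :=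
  fun _ _ hk _ ⟨j, hj, h⟩ => ⟨j, hj.trans_le hk, h⟩

variable [MeasurableSpace S] [DiscreteMeasurableSpace S]

theorem measurable_consPath (s : S) : Measurable (consPath s) := by
  refine measurable_pi_iff.2 fun i => ?_
  cases i with
  | zero => exact measurable_const
  | succ i => exact measurable_pi_apply i

theorem measurableSet_horizonSet (k r : ℕ) : MeasurableSet (M.horizonSet a b w k r) := by
  have hd : ∀ (p : S → Prop) (i : ℕ), MeasurableSet {π : ℕ → S | p (π i)} := fun p i =>
    (MeasurableSet.of_discrete (s := {x | p x})).preimage (measurable_pi_apply i)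
  have : M.horizonSet a b w k r = ⋃ j ∈ Finset.range k, {π : ℕ → S | b ∈ M.label (π j)} ∩
      ((⋂ i ∈ Finset.range j, {π : ℕ → S | a ∈ M.label (π i)}) ∩
        {π | ∑ i ∈ Finset.range j, w (π i) ≤ r}) := by
    ext π
    simp only [horizonSet, Set.mem_ofPred_eq, Finset.mem_range, Set.mem_iUnion, Set.mem_inter_iff,
      Set.mem_iInter, exists_prop]
  rw [this]
  refine Finset.measurableSet_biUnion _ fun j _ => (hd (fun x => b ∈ M.label x) j).inter
    ((Finset.measurableSet_biInter _ fun i _ => hd (fun x => a ∈ M.label x) i).inter ?_)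
  exact measurableSet_le (Finset.measurable_sum _ fun i _ =>
    (measurable_of_countable w).comp (measurable_pi_apply i)) measurable_const

theorem ext_of_cylinder {P Q : Measure (ℕ → S)} [IsFiniteMeasure P] [IsFiniteMeasure Q]
    (h : ∀ (x : ℕ → S) (k : ℕ), P {π | ∀ i ≤ k, π i = x i} = Q {π | ∀ i ≤ k, π i = x i}) :
    P = Q := by
  have hQ : IsProjectiveLimit Q fun I : Finset ℕ => Q.map I.restrict := fun I => rfl
  refine IsProjectiveLimit.unique ((isProjectiveLimit_nat_iff ?_ P).2 fun n => ?_) hQ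
  · intro I J hJI
    rw [Measure.map_map (Finset.measurable_restrict₂ hJI) (Finset.measurable_restrict I)]
    rfl
  · refine Measure.ext_of_singleton fun u => ?_
    change P.map (Preorder.frestrictLe n) {u} = Q.map (Preorder.frestrictLe n) {u}
    rw [Measure.map_apply (by fun_prop) (MeasurableSet.singleton _),
      Measure.map_apply (by fun_prop) (MeasurableSet.singleton _)]
    -- Any infinite extension of the word `u` would do; this one repeats its last letter.
    let x : ℕ → S := fun i => u ⟨min i n, Finset.mem_Iic.2 (min_le_right _ _)⟩
    have : Preorder.frestrictLe (π := fun _ => S) n ⁻¹' {u} = {π | ∀ i ≤ n, π i = x i} := by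
      ext π
      simp only [Set.mem_preimage, Set.mem_singleton_iff, funext_iff, Subtype.forall,
        Finset.mem_Iic, Preorder.frestrictLe_apply, Set.mem_ofPred_eq, x]
      exact forall₂_congr fun i hi => by simp [hi]
    rw [this]
    exact h x n

theorem pathMeasure_cylinder_of_ne (σ : M.Scheduler) {s : S} {x : ℕ → S} (h : x 0 ≠ s) (k : ℕ) :
    M.pathMeasure σ s {π | ∀ i ≤ k, π i = x i} = 0 := by
  have h1 := M.pathMeasure_cylinder σ (fun _ => s) 0
  simp only [Finset.range_zero, Finset.prod_empty, Nat.le_zero, forall_eq] at h1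
  have hm : MeasurableSet {π : ℕ → S | π 0 = s} :=
    (MeasurableSet.singleton s).preimage (measurable_pi_apply 0)
  have h2 : M.pathMeasure σ s {π | π 0 = s}ᶜ = 0 := by
    rw [prob_compl_eq_zero_iff hm]
    rw [measureReal_def] at h1
    exact (ENNReal.toReal_eq_one_iff _).1 h1
  refine measure_mono_null ?_ h2
  intro π hπ hs
  exact h ((hπ 0 (Nat.zero_le k)).symm.trans hs)

/-- Conditioning on the first step: both sides are finite measures with the same cylinder
probabilities, because the product formula splits off its first factor. -/
theorem pathMeasure_eq_sum (σ : M.Scheduler) (s : S) :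
    M.pathMeasure σ s = ∑ t, ENNReal.ofReal (M.δ s (σ.act 0 fun _ => s) t) •
      (M.pathMeasure (σ.tail s) t).map (consPath s) := by
  classical
  have : IsFiniteMeasure (∑ t, ENNReal.ofReal (M.δ s (σ.act 0 fun _ => s) t) •
      (M.pathMeasure (σ.tail s) t).map (consPath s)) := by
    refine ⟨?_⟩
    simp only [Measure.coe_finsetSum, Finset.sum_apply, Measure.smul_apply, smul_eq_mul]
    exact ENNReal.sum_lt_top.2 fun t _ => ENNReal.mul_lt_top ENNReal.ofReal_lt_top
      (by
        rw [Measure.map_apply (measurable_consPath s) MeasurableSet.univ]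
        exact measure_lt_top _ _)
  refine ext_of_cylinder fun x k => ?_
  have hm : MeasurableSet {π : ℕ → S | ∀ i ≤ k, π i = x i} := by
    have : {π : ℕ → S | ∀ i ≤ k, π i = x i} =
        ⋂ i ∈ Finset.Iic k, (fun π : ℕ → S => π i) ⁻¹' {x i} := by
      ext π
      simp
    rw [this]
    exact Finset.measurableSet_biInter _ fun i _ =>
      (MeasurableSet.singleton _).preimage (measurable_pi_apply i)
  simp only [Measure.coe_finsetSum, Finset.sum_apply, Measure.smul_apply, smul_eq_mul,
    Measure.map_apply (measurable_consPath s) hm]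
  by_cases hx : x 0 = s
  · subst hx
    rw [← ENNReal.ofReal_toReal (measure_ne_top (M.pathMeasure σ (x 0)) _), ← measureReal_def,
      M.pathMeasure_cylinder σ x k]
    have h0 : (fun j : Finset.Iic 0 => x j) = fun _ => x 0 := by
      funext j
      rw [Nat.le_zero.1 (Finset.mem_Iic.1 j.2)]
    cases k with
    | zero =>
      have : consPath (x 0) ⁻¹' {π | ∀ i ≤ 0, π i = x i} = Set.univ := by
        ext π
        simp [consPath]
      simp only [this, measure_univ, mul_one, Finset.range_zero, Finset.prod_empty]
      rw [← ENNReal.ofReal_sum_of_nonneg fun t _ => M.δ_nonneg _ _ t, M.δ_sum]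
    | succ k =>
      have hpre : consPath (x 0) ⁻¹' {π | ∀ i ≤ k + 1, π i = x i} =
          {π | ∀ i ≤ k, π i = x (i + 1)} := by
        ext π
        constructor
        · exact fun h i hi => h (i + 1) (by omega)
        · rintro h (_ | i) hi
          · rfl
          · exact h i (by omega)
      rw [hpre, Finset.sum_eq_single (x 1), Finset.prod_range_succ', mul_comm,
        ENNReal.ofReal_mul (M.δ_nonneg _ _ _), h0]
      · congr 1
        rw [← ENNReal.ofReal_toReal (measure_ne_top (M.pathMeasure (σ.tail (x 0)) (x 1)) _),
          ← measureReal_def,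
          M.pathMeasure_cylinder (σ.tail (x 0)) (fun i => x (i + 1)) k]
        congr 1
        refine Finset.prod_congr rfl fun i _ => ?_
        have : (fun j : Finset.Iic (i + 1) => x j) =
            consHist (x 0) fun j : Finset.Iic i => x (j + 1) := by
          funext ⟨j, hj⟩
          cases j <;> rfl
        rw [this]
        rfl
      · intro t _ ht
        rw [pathMeasure_cylinder_of_ne (x := fun i => x (i + 1)) _ ht.symm, mul_zero]
      · simp
  · have hpre : consPath s ⁻¹' {π | ∀ i ≤ k, π i = x i} = ∅ :=
      Set.eq_empty_of_forall_notMem fun π hπ => hx (hπ 0 (Nat.zero_le k)).symm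
    simp [hpre, pathMeasure_cylinder_of_ne σ hx]

theorem pathMeasure_real_eq_sum (σ : M.Scheduler) (s : S) {E : Set (ℕ → S)}
    (hE : MeasurableSet E) : (M.pathMeasure σ s).real E =
      M.expect s (σ.act 0 fun _ => s) fun t =>
        (M.pathMeasure (σ.tail s) t).real (consPath s ⁻¹' E) := by
  rw [measureReal_def, pathMeasure_eq_sum]
  simp only [Measure.coe_finsetSum, Finset.sum_apply, Measure.smul_apply, smul_eq_mul,
    Measure.map_apply (measurable_consPath s) hE]
  rw [ENNReal.toReal_sum fun t _ => ENNReal.mul_ne_top ENNReal.ofReal_ne_top (measure_ne_top _ _)]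
  simp [expect, measureReal_def, M.δ_nonneg]

theorem pathMeasure_horizonSet_goal (σ : M.Scheduler) {s : S} (h : b ∈ M.label s) (k r : ℕ) :
    (M.pathMeasure σ s).real (M.horizonSet a b w (k + 1) r) = 1 := by
  rw [pathMeasure_real_eq_sum σ s (measurableSet_horizonSet _ _)]
  have : consPath s ⁻¹' M.horizonSet a b w (k + 1) r = Set.univ :=
    Set.eq_univ_of_forall fun π => mem_horizonSet_cons.2 (Or.inl h)
  simp only [this, probReal_univ, expect_const]

theorem pathMeasure_horizonSet_stuck (σ : M.Scheduler) {s : S} {r : ℕ} (h : b ∉ M.label s)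
    (h' : ¬(a ∈ M.label s ∧ w s ≤ r)) (k : ℕ) :
    (M.pathMeasure σ s).real (M.horizonSet a b w (k + 1) r) = 0 := by
  rw [pathMeasure_real_eq_sum σ s (measurableSet_horizonSet _ _)]
  have : consPath s ⁻¹' M.horizonSet a b w (k + 1) r = ∅ :=
    Set.eq_empty_of_forall_notMem fun π hπ =>
      (mem_horizonSet_cons.1 hπ).elim h fun hh => h' hh.1
  simp only [this, measureReal_empty, expect_const]

theorem pathMeasure_horizonSet_step (σ : M.Scheduler) {s : S} {r : ℕ} (h : b ∉ M.label s)
    (h' : a ∈ M.label s ∧ w s ≤ r) (k : ℕ) :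
    (M.pathMeasure σ s).real (M.horizonSet a b w (k + 1) r) =
      M.expect s (σ.act 0 fun _ => s) fun t =>
        (M.pathMeasure (σ.tail s) t).real (M.horizonSet a b w k (r - w s)) := by
  rw [pathMeasure_real_eq_sum σ s (measurableSet_horizonSet _ _)]
  have : consPath s ⁻¹' M.horizonSet a b w (k + 1) r = M.horizonSet a b w k (r - w s) := by
    ext π
    rw [Set.mem_preimage, mem_horizonSet_cons]
    tauto
  rw [this]

theorem pathMeasure_horizonSet_zero (σ : M.Scheduler) (s : S) (r : ℕ) :
    (M.pathMeasure σ s).real (M.horizonSet a b w 0 r) = 0 := by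
  have : M.horizonSet a b w 0 r = ∅ := by simp [horizonSet]
  rw [this, measureReal_empty]

theorem pathMeasure_horizonSet_le [Finite Act] (σ : M.Scheduler) (s : S) (k r : ℕ) :
    (M.pathMeasure σ s).real (M.horizonSet a b w k r) ≤ M.horizonValue a b w k s r := by
  induction k generalizing σ s r with
  | zero => exact (pathMeasure_horizonSet_zero σ s r).le
  | succ k ih =>
    by_cases h : b ∈ M.label s
    · rw [pathMeasure_horizonSet_goal σ h, horizonValue_goal h]
    by_cases h' : a ∈ M.label s ∧ w s ≤ r
    · rw [pathMeasure_horizonSet_step σ h h']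
      exact (expect_mono fun t _ => ih _ _ _).trans
        (le_horizonValue_step h h' (σ.act_mem 0 fun _ => s))
    · rw [pathMeasure_horizonSet_stuck σ h h', horizonValue_stuck h h']

theorem pathMeasure_policyScheduler (μ : S → ℕ → Act) (hμ : ∀ t r, μ t r ∈ M.enabled t)
    (s : S) (k r : ℕ) : (M.pathMeasure (policyScheduler w μ hμ r) s).real
      (M.horizonSet a b w k r) = M.policyValue a b w μ k s r := by
  induction k generalizing s r with
  | zero => exact pathMeasure_horizonSet_zero _ s r
  | succ k ih =>
    by_cases h : b ∈ M.label s
    · rw [pathMeasure_horizonSet_goal _ h, policyValue_goal h]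
    by_cases h' : a ∈ M.label s ∧ w s ≤ r
    · rw [pathMeasure_horizonSet_step _ h h', policyScheduler_tail, policyValue_step h h']
      simp only [ih]
      simp [policyScheduler]
    · rw [pathMeasure_horizonSet_stuck _ h h', policyValue_stuck h h']

theorem pathMeasure_iUnion_horizonSet_le [Finite Act] (σ : M.Scheduler) (s : S) (r : ℕ) :
    (M.pathMeasure σ s).real (⋃ k, M.horizonSet a b w k r) ≤ M.optValue a b w s r := by
  have h := tendsto_measure_iUnion_atTop (μ := M.pathMeasure σ s)
    (horizonSet_mono (M := M) (a := a) (b := b) (w := w) (r := r))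
  have h' := (ENNReal.tendsto_toReal (measure_ne_top _ _)).comp h
  exact le_of_tendsto h' (Filter.Eventually.of_forall fun k =>
    (pathMeasure_horizonSet_le σ s k r).trans (horizonValue_le_optValue k s r))

theorem OptimalPolicy.optValue_le_pathMeasure [Finite Act] {μ : S → ℕ → Act}
    (hμ : OptimalPolicy M a b w μ) (s : S) (r : ℕ) : M.optValue a b w s r ≤
      (M.pathMeasure (policyScheduler w μ hμ.mem r) s).real (⋃ k, M.horizonSet a b w k r) := by
  refine hμ.optValue_le fun k => ?_
  rw [← pathMeasure_policyScheduler μ hμ.mem]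
  exact measureReal_mono (Set.subset_iUnion (fun k => M.horizonSet a b w k r) k)

end Paths

end MDP

namespace MDP

/-! ### From values to reward-bounded queries -/

section Query

variable {S Act AP : Type*} [Fintype S] {M : MDP S Act AP} {a b : AP} {w : S → ℕ}

theorem untilSet_eq_iUnion : M.untilSet a b = ⋃ k, M.horizonSet a b 0 k 0 := by
  ext π
  simp only [untilSet, horizonSet, Set.mem_ofPred_eq, Set.mem_iUnion]
  constructor
  · rintro ⟨j, hb, ha⟩
    exact ⟨j + 1, j, j.lt_succ_self, hb, ha, by simp⟩
  · rintro ⟨_, j, _, hb, ha, _⟩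
    exact ⟨j, hb, ha⟩

theorem untilLeSet_subset_untilSet (r : ℝ) : M.untilLeSet a b r ⊆ M.untilSet a b :=
  fun _ ⟨j, hb, ha, _⟩ => ⟨j, hb, ha⟩

/-- Accumulated rewards are integers, so rounding the bound down changes nothing. -/
theorem untilLeSet_eq_iUnion (hw : ∀ s, M.rew s = w s) {r : ℝ} (hr : 0 ≤ r) :
    M.untilLeSet a b r = ⋃ k, M.horizonSet a b w k ⌊r⌋₊ := by
  have hsum : ∀ (π : ℕ → S) j, ∑ i ∈ Finset.range j, (M.rew (π i) : ℝ) ≤ r ↔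
      ∑ i ∈ Finset.range j, w (π i) ≤ ⌊r⌋₊ := by
    intro π j
    rw [Nat.le_floor_iff hr]
    simp [hw]
  ext π
  simp only [untilLeSet, horizonSet, Set.mem_ofPred_eq, Set.mem_iUnion, hsum]
  constructor
  · rintro ⟨j, hj⟩
    exact ⟨j + 1, j, j.lt_succ_self, hj⟩
  · rintro ⟨_, j, _, hj⟩
    exact ⟨j, hj⟩

theorem untilLeSet_eq_empty {r : ℝ} (hr : r < 0) : M.untilLeSet a b r = ∅ := by
  refine Set.eq_empty_of_forall_notMem ?_
  rintro π ⟨j, _, _, h⟩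
  exact (h.trans_lt hr).not_ge (Finset.sum_nonneg fun i _ => NNReal.coe_nonneg _)

/-- Fewer than `N + 1` steps through `a`-states cost at most `N` times the maximal cost. -/
theorem horizonSet_subset_untilLeSet {c : ℝ} (hc : ∀ t, a ∈ M.label t → (M.rew t : ℝ) ≤ c)
    (hc0 : 0 ≤ c) (N : ℕ) : M.horizonSet a b 0 (N + 1) 0 ⊆ M.untilLeSet a b (N * c) := by
  rintro π ⟨j, hj, hb, ha, -⟩
  refine ⟨j, hb, ha, ?_⟩
  calc ∑ i ∈ Finset.range j, (M.rew (π i) : ℝ) ≤ ∑ _i ∈ Finset.range j, c :=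
        Finset.sum_le_sum fun i hi => hc _ (ha i (Finset.mem_range.1 hi))
    _ = j * c := by simp
    _ ≤ N * c := mul_le_mul_of_nonneg_right (by exact_mod_cast Nat.le_of_lt_succ hj) hc0

theorem rew_le_maxRew {t : S} (ht : a ∈ M.label t) : M.rew t ≤ M.maxRew a :=
  le_csSup (Set.toFinite _).bddAbove ⟨t, ht, rfl⟩

theorem exists_nat_maxRew (hw : ∀ s, M.rew s = w s) : ∃ c : ℕ, M.maxRew a = c := by
  rcases (M.labelled a).eq_empty_or_nonempty with h | h
  · exact ⟨0, by simp [maxRew, h]⟩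
  · obtain ⟨t, -, ht⟩ := (h.image M.rew).csSup_mem (Set.toFinite _)
    exact ⟨w t, by rw [maxRew, ← ht, hw]⟩

theorem inv_le_prob {m : ℕ} {x : ℚ} (hx : x.den ≤ m) (hpos : 0 < (x : ℝ)) :
    (m : ℝ)⁻¹ ≤ x := by
  have hx0 : 0 < x := by exact_mod_cast hpos
  have hden : (0 : ℝ) < x.den := by exact_mod_cast x.den_pos
  have h1 : (m : ℝ)⁻¹ ≤ (x.den : ℝ)⁻¹ := inv_anti₀ hden (by exact_mod_cast hx)
  refine h1.trans ?_
  rw [Rat.cast_def, ← one_div]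
  exact div_le_div_of_nonneg_right (by exact_mod_cast Rat.num_pos.2 hx0) hden.le

/-- From `1 - 1/x < exp (-1/x)`. Strictness makes the resulting probability exceed `p`, which
settles both comparisons at once. -/
theorem one_sub_inv_pow_lt {d : ℝ} {x : ℕ} {k : ℕ} (hx : 1 ≤ x) (hk : 1 ≤ k) (hd : 0 < d)
    (hkd : -(k : ℝ) ≤ Real.log d) : (1 - (x : ℝ)⁻¹) ^ (k * x) < d := by
  have hx1 : (1 : ℝ) ≤ x := by exact_mod_cast hx
  have hx0 : (0 : ℝ) < x := by linarith
  have h1 : 1 - (x : ℝ)⁻¹ < Real.exp (-(x : ℝ)⁻¹) := by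
    have := Real.add_one_lt_exp (x := -(x : ℝ)⁻¹) (neg_ne_zero.2 (inv_ne_zero hx0.ne'))
    linarith
  have h0 : 0 ≤ 1 - (x : ℝ)⁻¹ := sub_nonneg.2 (inv_le_one_of_one_le₀ hx1)
  calc (1 - (x : ℝ)⁻¹) ^ (k * x) < Real.exp (-(x : ℝ)⁻¹) ^ (k * x) :=
        pow_lt_pow_left₀ h1 h0 (Nat.mul_pos hk hx).ne'
    _ = Real.exp (-k) := by
        rw [← Real.exp_nat_mul]
        congr 1
        push_cast
        field_simp
    _ ≤ d := (Real.le_log_iff_exp_le hd).1 hkd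

theorem existsUntilValue_le [MeasurableSpace S] [DiscreteMeasurableSpace S] {cmp : LowerCmp}
    {p r : ℝ} {s : S} (h : M.ExistsUntilLe cmp p a b r s) :
    M.existsUntilValue cmp p a b s ≤ (r : EReal) :=
  sInf_le ⟨r, h, rfl⟩

theorem existsUntilValue_eq_top [MeasurableSpace S] [DiscreteMeasurableSpace S] {cmp : LowerCmp}
    {p : ℝ} {s : S} (h : ∀ r, ¬M.ExistsUntilLe cmp p a b r s) :
    M.existsUntilValue cmp p a b s = ⊤ := by
  have : {r : ℝ | M.ExistsUntilLe cmp p a b r s} = ∅ := Set.eq_empty_of_forall_notMem h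
  rw [existsUntilValue, this, Set.image_empty, sInf_empty]

theorem LowerCmp.holds_of_gt {cmp : LowerCmp} {x p : ℝ} (h : p < x) : cmp.holds x p := by
  cases cmp
  · exact h.le
  · exact h

variable [Finite Act] [MeasurableSpace S] [DiscreteMeasurableSpace S]

variable (M a b) in
theorem isGreatest_optValue (s : S) :
    IsGreatest (Set.range fun σ : M.Scheduler => (M.pathMeasure σ s).real (M.untilSet a b))
      (M.optValue a b 0 s 0) := by
  obtain ⟨μ, hμ⟩ := exists_optimalPolicy M a b 0
  have hle : ∀ σ : M.Scheduler,
      (M.pathMeasure σ s).real (M.untilSet a b) ≤ M.optValue a b 0 s 0 := fun σ => by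
    rw [untilSet_eq_iUnion]
    exact pathMeasure_iUnion_horizonSet_le σ s 0
  refine ⟨⟨policyScheduler 0 μ hμ.mem 0, le_antisymm (hle _) ?_⟩, ?_⟩
  · simp only [untilSet_eq_iUnion]
    exact hμ.optValue_le_pathMeasure s 0
  · rintro _ ⟨σ, rfl⟩
    exact hle σ

/-- If some bound suffices for the maximal probability, then `n c` does. -/
theorem existsUntilLe_ncard_mul (hw : ∀ s, M.rew s = w s) {s : S} {r : ℝ}
    (h : M.ExistsUntilLe .ge (M.optValue a b 0 s 0) a b r s) :
    M.ExistsUntilLe .ge (M.optValue a b 0 s 0) a b ((M.labelled a).ncard * M.maxRew a) s := by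
  obtain ⟨c, hc⟩ := exists_nat_maxRew (a := a) hw
  have hwc : ∀ t, a ∈ M.label t → w t ≤ c := fun t ht => by
    have := rew_le_maxRew ht
    rw [hc, hw] at this
    exact_mod_cast this
  obtain ⟨σ, hσ⟩ := h
  change M.optValue a b 0 s 0 ≤ _ at hσ
  have hopt : M.optValue a b w s ⌊r⌋₊ = M.optValue a b 0 s 0 := by
    refine le_antisymm (optValue_le_free _ _) (hσ.trans ?_)
    rcases lt_or_ge r 0 with hr | hr
    · rw [untilLeSet_eq_empty hr, measureReal_empty]
      exact optValue_nonneg _ _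
    · rw [untilLeSet_eq_iUnion hw hr]
      exact pathMeasure_iUnion_horizonSet_le σ s _
  obtain ⟨μ, hμ⟩ := exists_optimalPolicy M a b w
  refine ⟨policyScheduler w μ hμ.mem ((M.labelled a).ncard * c), ?_⟩
  change M.optValue a b 0 s 0 ≤ _
  have hcast : ((M.labelled a).ncard * M.maxRew a : ℝ) = ((M.labelled a).ncard * c : ℕ) := by
    rw [hc]
    push_cast
    rfl
  rw [hcast, untilLeSet_eq_iUnion hw (Nat.cast_nonneg _), Nat.floor_natCast,
    ← optValue_ncard_mul_eq_free hwc hopt]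
  exact hμ.optValue_le_pathMeasure s _

/-- Every probability below the maximal one is exceeded within `k n m ^ n` steps. -/
theorem existsUntilLe_of_lt {m : ℕ}
    (hm : ∀ s, ∀ α ∈ M.enabled s, ∀ t, ∃ x : ℚ, M.δ s α t = x ∧ x.den ≤ m)
    (cmp : LowerCmp) {p : ℝ} {s : S} (hp : p < M.optValue a b 0 s 0) {k : ℕ} (hk : 1 ≤ k)
    (hkp : -(k : ℝ) ≤ Real.log (M.optValue a b 0 s 0 - p)) :
    M.ExistsUntilLe cmp p a b
      (((M.labelled a).ncard * (k * m ^ (M.labelled a).ncard) : ℕ) * M.maxRew a) s := by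
  set n := (M.labelled a).ncard
  have hm1 : 1 ≤ m := by
    obtain ⟨α, hα⟩ := M.enabled_nonempty s
    obtain ⟨x, -, hx⟩ := hm s α hα s
    exact x.den_pos.trans_le hx
  obtain ⟨μ, hμ⟩ := exists_optimalPolicy M a b 0
  refine ⟨policyScheduler 0 μ hμ.mem 0, LowerCmp.holds_of_gt ?_⟩
  -- The policy ignores rewards; they enter only through the bound on the number of steps.
  refine lt_of_lt_of_le ?_ (measureReal_mono (horizonSet_subset_untilLeSet
    (fun t ht => NNReal.coe_le_coe.2 (rew_le_maxRew ht)) (NNReal.coe_nonneg _) _))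
  rw [pathMeasure_policyScheduler]
  have hloss := hμ.loss_le_pow (N := n) (R := 0) (ε := (m : ℝ)⁻¹) (by positivity)
    (inv_le_one_of_one_le₀ (by exact_mod_cast hm1))
    (fun t α hα t' hpos => by
      obtain ⟨x, hx, hxm⟩ := hm t α hα t'
      rw [hx] at hpos ⊢
      exact inv_le_prob hxm hpos)
    (fun t r hr hpos => by
      obtain rfl : r = 0 := by omega
      exact exists_reachOpt_le_ncard hpos) (k * m ^ n) s 0 le_rfl
  have hlt := one_sub_inv_pow_lt (x := m ^ n) (Nat.one_le_pow _ _ hm1) hk (sub_pos.2 hp) hkp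
  rw [Nat.cast_pow, ← inv_pow] at hlt
  linarith

end Query

end MDP

theorem mainTheorem5 {S Act AP : Type*} [Fintype S] [Finite Act]
    [MeasurableSpace S] [DiscreteMeasurableSpace S]
    (M : MDP S Act AP)
    (hrew : ∀ s, ∃ j : ℕ, M.rew s = j)
    (m : ℕ)
    (hm : ∀ s, ∀ α ∈ M.enabled s, ∀ t, ∃ x : ℚ, M.δ s α t = x ∧ x.den ≤ m)
    (cmp : MDP.LowerCmp) (p : ℝ) (hp0 : 0 ≤ p) (hp1 : p ≤ 1)
    (a b : AP) (s : S) (n : ℕ) (hn : n = (M.labelled a).ncard)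
    (c : ℝ) (hc : c = M.maxRew a) :
    ∃ q : ℝ,
      IsGreatest (Set.range fun σ : M.Scheduler => (M.pathMeasure σ s).real (M.untilSet a b)) q ∧
      ((p ≥ q ∧ M.existsUntilValue cmp p a b s = ⊤) ∨
        (p = q ∧ cmp = .ge ∧ M.existsUntilValue cmp p a b s ≤ ((n * c : ℝ) : EReal)) ∨
        (p < q ∧ M.existsUntilValue cmp p a b s ≤
          (((max (-⌊Real.log (q - p)⌋) 1 : ℤ) * n * c * m ^ n : ℝ) : EReal))) := by
  choose w hw using hrew
  have hgreat := M.isGreatest_optValue a b s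
  refine ⟨M.optValue a b 0 s 0, hgreat, ?_⟩
  subst hn hc
  rcases lt_or_ge p (M.optValue a b 0 s 0) with hlt | hge
  · refine Or.inr (Or.inr ⟨hlt, ?_⟩)
    obtain ⟨k, hk⟩ := Int.eq_ofNat_of_zero_le
      (zero_le_one.trans (le_max_right (-⌊Real.log (M.optValue a b 0 s 0 - p)⌋) 1))
    have hk1 : 1 ≤ k := by
      have := le_max_right (-⌊Real.log (M.optValue a b 0 s 0 - p)⌋) 1
      omega
    have hkl : -(k : ℝ) ≤ Real.log (M.optValue a b 0 s 0 - p) := by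
      have h1 : -(k : ℤ) ≤ ⌊Real.log (M.optValue a b 0 s 0 - p)⌋ := by
        have := le_max_left (-⌊Real.log (M.optValue a b 0 s 0 - p)⌋) 1
        omega
      exact_mod_cast Int.le_floor.1 h1
    refine (MDP.existsUntilValue_le (MDP.existsUntilLe_of_lt hm cmp hlt hk1 hkl)).trans
      (le_of_eq ?_)
    rw [hk]
    congr 1
    push_cast
    ring
  -- A bound that works has probability at most `q ≤ p`, which excludes `>` and forces `p = q`.
  · by_cases hex : ∃ r, M.ExistsUntilLe cmp p a b r s
    · obtain ⟨r, σ, hσ⟩ := hex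
      have hle : (M.pathMeasure σ s).real (M.untilLeSet a b r) ≤ M.optValue a b 0 s 0 :=
        (measureReal_mono (MDP.untilLeSet_subset_untilSet r)).trans (hgreat.2 ⟨σ, rfl⟩)
      cases cmp with
      | gt => exact absurd (hle.trans hge) (not_le.2 hσ)
      | ge =>
        obtain rfl : p = M.optValue a b 0 s 0 := le_antisymm (le_trans hσ hle) hge
        exact Or.inr (Or.inl ⟨rfl, rfl,
          MDP.existsUntilValue_le (MDP.existsUntilLe_ncard_mul hw ⟨σ, hσ⟩)⟩)
    · exact Or.inl ⟨hge, MDP.existsUntilValue_eq_top fun r hr => hex ⟨r, hr⟩⟩
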